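/- **Setting.** Let $X\in\mathbb{R}^{n\times p}$ have rows $x_1,\dots,x_n$, let $y\in\mathbb{R}^n$, $\Sigma=\frac1n X^\dagger X$, and let $\hat\theta=(X^\dagger X)^{-1}X^\dagger y$ be the OLS solution. For a step size $\eta>0$, noise scale $\lambda>0$ and initial vector $\theta_0$, *DP-GD without clipping* produces $$\theta_t=\theta_{t-1}+\frac{\eta}{n}\sum_{i=1}^n x_i\,(y_i-x_i^\dagger\theta_{t-1})+\eta z_t ,\qquad z_1,z_2,\dots\ \text{i.i.d. } \mathcal N(0,\lambda^2 I).$$ The data $(X,y)$ satisfy the *No-Clipping Condition* with values $(\sigma,\eta,c_0,N)$ if $\frac12 I\preceq\Sigma\preceq 2I$, $\|I-\eta\Sigma\|\le\frac78$, and there is a $\theta\in\mathbb{R}^p$ such that for all $i\in\{1,\dots,n\}$ and $t\in\{1,\dots,N\}$: $\|x_i\|\le c_0\sqrt p$; $|y_i-x_i^\dagger\theta|\le c_0\sigma$; $|x_i^\dagger(I-\eta\Sigma)^t\theta|\le c_0$; and $\bigl|\sum_{j=1}^n (y_j-x_j^\dagger\theta)\,x_i^\dagger A_t x_j\bigr|\le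 c_0\sigma\sqrt{np}$, where $A_t=(I-(I-\eta\Sigma)^t)\Sigma^{-1}$. Given estimates $\theta^{(1)},\dots,\theta^{(m)}\in\mathbb{R}^p$ with $m\ge2$, let $\bar\theta_j=\frac1m\sum_\ell\theta^{(\ell)}_j$ and $\hat\sigma_j^2=\frac1{m-1}\sum_\ell(\theta^{(\ell)}_j-\bar\theta_j)^2$, and let $t_{\alpha/2,m-1}$ be the $\alpha/2$ quantile of Student's $t$ distribution with $m-1$ degrees of freedom. **Theorem (Coverage).** For all real $c_0$ and $R$ there is a constant $c>0$, depending only on $c_0$ and $R$, such that the following holds for all $n,p,T$, all $m\ge 2$, all data sets $(X,y)$, all $\sigma\ge0$, $\eta,\lambda>0$, $\alpha,\beta\in(0,1)$, and all $\theta_0$ with $\|\theta_0\|\le R$. Suppose that $(X,y)$ satisfies the No-Clipping Condition with values $(\sigma,\eta,c_0,mT)$ and that $$T\ \ge\ c\,\log\frac{\max\{\sigma,1,\eta\lambda\}\,m\,p}{\eta\lambda\beta}$$ (when $\sigma\ge\max\{1,\eta\lambda\}$, this reads $T\ge c\log\frac{\sigma mp}{\eta\lambda\beta}$). Then for every coordinate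 $j$ the interval with end points $$\bar\theta_j\pm t_{\alpha/2,m-1}\cdot\frac{\hat\sigma_j}{\sqrt m}$$ contains $\hat\theta_j$ with probability at least $1-\alpha-\beta$, when the estimates are produced in either of the following ways: - *Independent runs:* $\theta^{(\ell)}$ is the final iterate of the $\ell$-th of $m$ independent runs of DP-GD without clipping, each with $T$ steps. - *Checkpoints:* $\theta^{(\ell)}=\theta_{\ell T}$ in a single run of DP-GD without clipping with $mT$ steps. -/

import Mathlib

open MeasureTheory ProbabilityTheory
open scoped ENNReal

/-- Vectors of `ℝ^p` with the Euclidean norm. -/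
abbrev Vec (p : ℕ) : Type := EuclideanSpace ℝ (Fin p)

/-- A square matrix as a continuous linear map of Euclidean space; its norm is the spectral norm. -/
noncomputable abbrev opOf {p : ℕ} (A : Matrix (Fin p) (Fin p) ℝ) : Vec p →L[ℝ] Vec p :=
  Matrix.toEuclideanCLM (𝕜 := ℝ) A

/-- The covariate vector `x_i`, the `i`-th row of the design matrix. -/
def covariate {n p : ℕ} (X : Matrix (Fin n) (Fin p) ℝ) (i : Fin n) : Vec p :=
  WithLp.toLp 2 (X i)

/-- The empirical covariance `Σ = (1/n) Xᵀ X`. -/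
noncomputable def empCov {n p : ℕ} (X : Matrix (Fin n) (Fin p) ℝ) : Matrix (Fin p) (Fin p) ℝ :=
  ((n : ℝ)⁻¹) • (X.transpose * X)

/-- The ordinary least squares solution `(Xᵀ X)⁻¹ Xᵀ y`. -/
noncomputable def olsSolution {n p : ℕ} (X : Matrix (Fin n) (Fin p) ℝ) (y : Fin n → ℝ) : Vec p :=
  WithLp.toLp 2 (((X.transpose * X)⁻¹ * X.transpose).mulVec y)

/-- The No-Clipping Condition on the data set `(X, y)` with values `(σ, η, c₀, T)`. -/
def NoClippingCondition {n p : ℕ} (X : Matrix (Fin n) (Fin p) ℝ) (y : Fin n → ℝ)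
    (σ η c₀ : ℝ) (T : ℕ) : Prop :=
  (empCov X - (1 / 2 : ℝ) • (1 : Matrix (Fin p) (Fin p) ℝ)).PosSemidef ∧
  ((2 : ℝ) • (1 : Matrix (Fin p) (Fin p) ℝ) - empCov X).PosSemidef ∧
  ‖opOf (1 - η • empCov X)‖ ≤ 7 / 8 ∧
  ∃ θ : Vec p, ∀ i : Fin n, ∀ t ∈ Finset.Icc 1 T,
    ‖covariate X i‖ ≤ c₀ * √p ∧
    |y i - inner ℝ (covariate X i) θ| ≤ c₀ * σ ∧
    |inner ℝ (covariate X i) (opOf ((1 - η • empCov X) ^ t) θ)| ≤ c₀ ∧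
    |∑ j : Fin n, (y j - inner ℝ (covariate X j) θ) *
        inner ℝ (covariate X i)
          (opOf ((1 - (1 - η • empCov X) ^ t) * (empCov X)⁻¹) (covariate X j))|
      ≤ c₀ * σ * √(n * p)

/-- `CLIP_γ(x) = x · min {1, γ / ‖x‖}`; `γ = ∞` means no clipping. -/
noncomputable def clip {p : ℕ} (γ : ℝ≥0∞) (x : Vec p) : Vec p :=
  (min 1 (γ / ‖x‖ₑ)).toReal • x

theorem clip_top {p : ℕ} (x : Vec p) : clip ⊤ x = x := by
  unfold clip
  rw [ENNReal.top_div_of_ne_top (by simp)]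
  simp

/-- The averaged clipped gradient of the squared loss at `θ`. -/
noncomputable def clippedGradient {n p : ℕ} (X : Matrix (Fin n) (Fin p) ℝ) (y : Fin n → ℝ)
    (γ : ℝ≥0∞) (θ : Vec p) : Vec p :=
  ((n : ℝ)⁻¹) • ∑ i : Fin n,
    clip γ (-((y i - inner ℝ (covariate X i) θ) • covariate X i))

/-- The iterates `θ_0, θ_1, θ_2, …` of DP-GD driven by the noise vectors `z_1, z_2, …`
(the value `z 0` is not used). -/
noncomputable def dpgdIterate {n p : ℕ} (X : Matrix (Fin n) (Fin p) ℝ) (y : Fin n → ℝ)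
    (γ : ℝ≥0∞) (η : ℝ) (θ₀ : Vec p) (z : ℕ → Vec p) : ℕ → Vec p
  | 0 => θ₀
  | t + 1 =>
      dpgdIterate X y γ η θ₀ z t
        - η • clippedGradient X y γ (dpgdIterate X y γ η θ₀ z t) + η • z (t + 1)

/-- The random vectors `z i` are independent, each with law `N(0, lam² I)`. -/
def IsGaussianNoise {Ω : Type*} [MeasurableSpace Ω] {ι : Type*} {p : ℕ} (P : Measure Ω)
    (lam : ℝ) (z : ι → Ω → Vec p) : Prop :=
  (∀ i, HasLaw (z i) (multivariateGaussian 0 ((lam ^ 2) • (1 : Matrix (Fin p) (Fin p) ℝ))) P) ∧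
  iIndepFun z P

/-- Student's `t` distribution with `ν` degrees of freedom: the law of
`g_0 / √((g_1² + ⋯ + g_ν²) / ν)` for independent standard normal variables `g_0, …, g_ν`. -/
noncomputable def studentT (ν : ℕ) : Measure ℝ :=
  (Measure.pi (fun _ : Fin (ν + 1) => gaussianReal 0 1)).map
    (fun g => g 0 / √((∑ i : Fin ν, g i.succ ^ 2) / ν))

/-- The `a`-th quantile `t_{a,ν}` of Student's `t` distribution with `ν` degrees of freedom. -/
noncomputable def tQuantile (a : ℝ) (ν : ℕ) : ℝ :=
  sInf {x : ℝ | a ≤ (studentT ν).real (Set.Iic x)}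

/-- The `j`-th coordinate of the sample mean of the estimates. -/
noncomputable def sampleMean {m p : ℕ} (est : Fin m → Vec p) (j : Fin p) : ℝ :=
  ((m : ℝ)⁻¹) * ∑ l : Fin m, est l j

/-- The sample standard deviation of the `j`-th coordinate of the estimates. -/
noncomputable def sampleSD {m p : ℕ} (est : Fin m → Vec p) (j : Fin p) : ℝ :=
  √(((m : ℝ) - 1)⁻¹ * ∑ l : Fin m, (est l j - sampleMean est j) ^ 2)

/-- The interval with end points `mean ± t_{α/2,m-1} · SD / √m`. For `α < 1` the quantile
`t_{α/2,m-1}` is nonpositive, hence the unordered interval. -/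
noncomputable def confInterval {m p : ℕ} (α : ℝ) (est : Fin m → Vec p) (j : Fin p) : Set ℝ :=
  Set.uIcc (sampleMean est j - tQuantile (α / 2) (m - 1) * (sampleSD est j / √m))
    (sampleMean est j + tQuantile (α / 2) (m - 1) * (sampleSD est j / √m))

/-!
Without clipping, the error `θ_t - θ̂` to the least squares solution obeys the affine recursion
`e ↦ M e + η z` with `M = I - ηΣ` and `‖M‖ ≤ 7/8` (`dpgdIterate_add_sub_olsSolution`). In both
ways of producing the estimates, the `l`-th estimate is therefore `θ̂` plus `M^T D_l` plus the noise
accumulated in a block of `T` steps, the blocks being disjoint for different `l`. Here `D_l` is the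
initial error for independent runs, and the error at the previous checkpoint for a single run. In
coordinate `j` this reads `θ̂_j + s_l + ξ_l`, where the `ξ_l` are i.i.d. centred Gaussian variables
of standard deviation at least `η lam`, and `s_l` is independent of `ξ_l`.

If all `s_l` were zero, the interval would cover `θ̂_j` with probability at least `1 - α`, since the
studentised mean of i.i.d. centred Gaussians has exactly Student's `t` distribution
(`one_sub_le_pi_gaussianReal_coverSet`). Shifting a Gaussian variable of standard deviation `τ` by
an independent amount `s` changes probabilities by at most `2 E|s| / τ`
(`gaussianReal_zero_le_gaussianReal_add`); replacing one coordinate at a time, the whole vector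
`(s_l + ξ_l)` costs at most the sum of these terms (`measure_mem_le_measure_add_mem`), although in
a single run the shifts depend on the noise of earlier blocks.

Finally `|s_l| ≤ (7/8)^(T-1) ‖M D_l‖`, and `E‖M D_l‖` is at most a constant times
`max {σ, 1, η lam} p` (`NoClippingCondition.norm_step_initial_error_le`,
`lintegral_norm_step_error_le`), so that a number of steps logarithmic in this size brings the sum
of the costs below `β` (`bias_le_of_log_le`).
-/

/-! ### Shifts of Gaussian variables -/

theorem integral_abs_gaussianReal_le {v : NNReal} :
    ∫ x, |x| ∂(gaussianReal 0 v) ≤ √v := by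
  have hi : Integrable (fun x : ℝ => x) (gaussianReal 0 v) :=
    (memLp_id_gaussianReal' 1 (by simp)).integrable le_rfl
  have hi2 : Integrable (fun x : ℝ => x ^ 2) (gaussianReal 0 v) :=
    (memLp_id_gaussianReal' 2 (by simp)).integrable_sq
  rcases eq_or_ne v 0 with rfl | hv
  · simp
  have hv' : 0 < √(v : ℝ) := Real.sqrt_pos.2 (by positivity)
  have h2 : ∫ x, x ^ 2 ∂(gaussianReal 0 v) = v := by
    have h := variance_fun_id_gaussianReal (μ := 0) (v := v)
    rwa [variance_of_integral_eq_zero (by fun_prop) (by simp)] at h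
  calc ∫ x, |x| ∂(gaussianReal 0 v)
      ≤ ∫ x, (√v / 2 + x ^ 2 / (2 * √v)) ∂(gaussianReal 0 v) := by
        refine integral_mono hi.abs ((integrable_const _).add (hi2.div_const _)) fun x => ?_
        simp only
        have : √(v : ℝ) / 2 + x ^ 2 / (2 * √v) - |x| = (√v - |x|) ^ 2 / (2 * √v) := by
          rw [← sq_abs x]; field_simp; ring
        have : 0 ≤ (√(v : ℝ) - |x|) ^ 2 / (2 * √v) := by positivity
        linarith
    _ = √v := by
        rw [integral_add (integrable_const _) (hi2.div_const _),
          integral_div _ (fun x : ℝ => x ^ 2), h2]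
        simp only [integral_const, probReal_univ, one_smul]
        have := Real.sq_sqrt v.coe_nonneg
        field_simp; linarith

/-- A Gaussian law is within `2|s|/√v` in total variation of its translate by `s`. If `L` is the
log-likelihood ratio of the two laws, then `1 - e^L ≤ |L|`, and `|L|` is integrated against the
centred law. -/
theorem gaussianReal_zero_le_gaussianReal_add {v : NNReal} (hv : v ≠ 0) (s : ℝ) (B : Set ℝ) :
    gaussianReal 0 v B ≤ gaussianReal s v B + ENNReal.ofReal (2 * |s| / √v) := by
  have hv0 : (0 : ℝ) < v := by positivity
  have hv' : 0 < √(v : ℝ) := Real.sqrt_pos.2 hv0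
  have hsq := Real.sq_sqrt v.coe_nonneg
  -- A large shift makes the bound at least `1`; a small one makes the quadratic part
  -- `s² / (2v)` of `|L|` smaller than `|s| / √v`.
  rcases le_total (√(v : ℝ)) (2 * |s|) with h1 | h1
  · calc gaussianReal 0 v B ≤ 1 := prob_le_one
      _ ≤ ENNReal.ofReal (2 * |s| / √v) := by
        rw [ENNReal.one_le_ofReal, one_le_div hv']; exact h1
      _ ≤ _ := le_add_self
  have hi : Integrable (fun x : ℝ => x) (gaussianReal 0 v) :=
    (memLp_id_gaussianReal' 1 (by simp)).integrable le_rfl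
  have hpt : ∀ x, gaussianPDF 0 v x ≤ gaussianPDF s v x +
      gaussianPDF 0 v x * ENNReal.ofReal (s ^ 2 / (2 * v) + |s| / v * |x|) := by
    intro x
    simp only [gaussianPDF]
    rw [← ENNReal.ofReal_mul (gaussianPDFReal_nonneg _ _ _),
      ← ENNReal.ofReal_add (gaussianPDFReal_nonneg _ _ _)
        (mul_nonneg (gaussianPDFReal_nonneg _ _ _) (by positivity))]
    apply ENNReal.ofReal_le_ofReal
    have hr : gaussianPDFReal s v x =
        gaussianPDFReal 0 v x * Real.exp (s * x / v - s ^ 2 / (2 * v)) := by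
      simp only [gaussianPDFReal, mul_assoc, ← Real.exp_add]
      congr 3
      field_simp; ring
    have he := Real.add_one_le_exp (s * x / v - s ^ 2 / (2 * v))
    have ha : -(|s| / v * |x|) ≤ s * x / v := by
      have := neg_abs_le (s * x / v)
      rwa [abs_div, abs_mul, abs_of_pos hv0, mul_div_right_comm] at this
    rw [hr, ← mul_add]
    exact le_mul_of_one_le_right (gaussianPDFReal_nonneg _ _ _) (by linarith)
  calc gaussianReal 0 v B = ∫⁻ x in B, gaussianPDF 0 v x := gaussianReal_apply 0 hv B
    _ ≤ ∫⁻ x in B, (gaussianPDF s v x +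
          gaussianPDF 0 v x * ENNReal.ofReal (s ^ 2 / (2 * v) + |s| / v * |x|)) :=
        lintegral_mono hpt
    _ = gaussianReal s v B + ∫⁻ x in B,
          gaussianPDF 0 v x * ENNReal.ofReal (s ^ 2 / (2 * v) + |s| / v * |x|) := by
        rw [lintegral_add_left (measurable_gaussianPDF _ _), gaussianReal_apply s hv B]
    _ ≤ gaussianReal s v B + ∫⁻ x,
          gaussianPDF 0 v x * ENNReal.ofReal (s ^ 2 / (2 * v) + |s| / v * |x|) := by
        exact add_le_add le_rfl (setLIntegral_le_lintegral _ _)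
    _ = gaussianReal s v B +
          ∫⁻ x, ENNReal.ofReal (s ^ 2 / (2 * v) + |s| / v * |x|) ∂(gaussianReal 0 v) := by
        rw [gaussianReal_of_var_ne_zero 0 hv,
          lintegral_withDensity_eq_lintegral_mul _ (measurable_gaussianPDF _ _) (by fun_prop)]
        rfl
    _ ≤ _ := by
        gcongr
        have hint : Integrable (fun x : ℝ => s ^ 2 / (2 * v) + |s| / v * |x|)
            (gaussianReal 0 v) := (integrable_const _).add (hi.abs.const_mul _)
        rw [← ofReal_integral_eq_lintegral_ofReal hint (.of_forall fun x => by positivity)]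
        apply ENNReal.ofReal_le_ofReal
        rw [integral_add (integrable_const _) (hi.abs.const_mul _), integral_const_mul]
        simp only [integral_const, probReal_univ, one_smul]
        have h3 : |s| / v * ∫ x, |x| ∂(gaussianReal 0 v) ≤ |s| / v * √v := by
          gcongr; exact integral_abs_gaussianReal_le
        have h4 : |s| / v * √v = |s| / √v := by
          rw [← hsq]; field_simp; simp
        have h5 : s ^ 2 / (2 * v) ≤ |s| / √v := by
          rw [div_le_div_iff₀ (by positivity) hv', ← sq_abs]
          nth_rewrite 2 [← hsq]
          nlinarith [abs_nonneg s, mul_nonneg (abs_nonneg s) hv'.le]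
        have h6 : 2 * |s| / √v = |s| / √v + |s| / √v := by ring
        linarith

/-- A Gaussian variable may be shifted by a random amount that is independent of it, at a cost
proportional to the mean size of the shift, even jointly with the variable that determines the
shift. -/
theorem measure_prod_mem_le_of_indepFun_gaussian {Ω 𝓤 : Type*} [MeasurableSpace Ω]
    [MeasurableSpace 𝓤] {P : Measure Ω} [IsProbabilityMeasure P] {v : NNReal} (hv : v ≠ 0)
    {U : Ω → 𝓤} {X : Ω → ℝ} (hU : Measurable U) (hXm : Measurable X)
    (hX : P.map X = gaussianReal 0 v)
    (hind : IndepFun U X P) {s : 𝓤 → ℝ} (hs : Measurable s) {B : Set (𝓤 × ℝ)}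
    (hB : MeasurableSet B) :
    P {ω | (U ω, X ω) ∈ B} ≤ P {ω | (U ω, s (U ω) + X ω) ∈ B} +
      ∫⁻ ω, ENNReal.ofReal (2 * |s (U ω)| / √v) ∂P := by
  have hlaw := (indepFun_iff_map_prod_eq_prod_map_map hU.aemeasurable hXm.aemeasurable).1 hind
  rw [hX] at hlaw
  have : IsProbabilityMeasure (P.map U) := Measure.isProbabilityMeasure_map hU.aemeasurable
  have hB' : MeasurableSet {q : 𝓤 × ℝ | (q.1, s q.1 + q.2) ∈ B} :=
    (by fun_prop : Measurable fun q : 𝓤 × ℝ => (q.1, s q.1 + q.2)) hB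
  have e1 : ∀ {C : Set (𝓤 × ℝ)}, MeasurableSet C → P {ω | (U ω, X ω) ∈ C} =
      ∫⁻ u, gaussianReal 0 v (Prod.mk u ⁻¹' C) ∂(P.map U) := by
    intro C hC
    rw [← Measure.prod_apply hC, ← hlaw, Measure.map_apply (hU.prodMk hXm) hC]
    rfl
  have e2 := e1 hB'
  simp only [Set.mem_ofPred_eq] at e2
  have hms : Measurable fun u => ENNReal.ofReal (2 * |s u| / √v) :=
    ((hs.abs.const_mul 2).div_const _).ennreal_ofReal
  rw [e1 hB, e2, ← lintegral_map (f := fun u => ENNReal.ofReal (2 * |s u| / √v)) hms hU,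
    ← lintegral_add_right _ hms]
  refine lintegral_mono fun u => ?_
  refine (gaussianReal_zero_le_gaussianReal_add hv (s u) _).trans_eq ?_
  congr 1
  have h := gaussianReal_map_const_add (μ := 0) (v := v) (s u)
  rw [zero_add] at h
  rw [← h, Measure.map_apply (by fun_prop) (measurable_prodMk_left hB)]
  rfl

/-- Shifting i.i.d. Gaussian variables `ξ k` by amounts `s k`, each independent of `ξ k` but
possibly dependent on the earlier variables: the probability of an event drops by at most the sum
of the costs of the single shifts. The σ-algebra `ℱ k` stands for everything independent of
`ξ k`. -/
theorem measure_mem_le_measure_add_mem {Ω : Type*} [MeasurableSpace Ω] {P : Measure Ω}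
    [IsProbabilityMeasure P] {m : ℕ} {v : NNReal} (hv : v ≠ 0) {ξ s : Fin m → Ω → ℝ}
    {ℱ : Fin m → MeasurableSpace Ω}
    (hξm : ∀ k, Measurable (ξ k)) (hlaw : ∀ k, P.map (ξ k) = gaussianReal 0 v)
    (hsm : ∀ k, Measurable (s k))
    (hξF : ∀ k i, i ≠ k → Measurable[ℱ k] (ξ i)) (hsF : ∀ k i, i ≤ k → Measurable[ℱ k] (s i))
    (hind : ∀ k, Indep (ℱ k) (MeasurableSpace.comap (ξ k) inferInstance) P)
    {δ : ℝ≥0∞} (hδ : ∀ k, ∫⁻ ω, ENNReal.ofReal (2 * |s k ω| / √v) ∂P ≤ δ)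
    {A : Set (Fin m → ℝ)} (hA : MeasurableSet A) :
    P {ω | (fun i => ξ i ω) ∈ A} ≤ P {ω | (fun i => s i ω + ξ i ω) ∈ A} + m * δ := by
  -- Hybrid argument: the coordinates are shifted one at a time, the earliest first.
  suffices H : ∀ k : ℕ, k ≤ m → P {ω | (fun i => ξ i ω) ∈ A} ≤
      P {ω | (fun i : Fin m => if (i : ℕ) < k then s i ω + ξ i ω else ξ i ω) ∈ A} + k * δ by
    simpa using H m le_rfl
  intro k
  induction k with
  | zero => simp
  | succ k ih =>
    intro hk
    refine (ih (by omega)).trans ?_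
    set κ : Fin m := ⟨k, hk⟩ with hκ
    -- `U` carries the coordinates other than `κ` and, in place `κ`, the shift about to be applied.
    set U : Ω → Fin m → ℝ := fun ω i =>
      if (i : ℕ) < k then s i ω + ξ i ω else if i = κ then s i ω else ξ i ω with hUdef
    have hUF : Measurable[ℱ κ] U := by
      refine @measurable_pi_lambda _ _ _ (ℱ κ) _ _ fun i => ?_
      by_cases h1 : (i : ℕ) < k
      · have : i ≠ κ := by rintro rfl; simp [hκ] at h1
        simp only [hUdef, h1, if_true]
        have h3 : i ≤ κ := Fin.le_def.2 (by simpa [hκ] using h1.le)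
        exact @Measurable.add ℝ _ _ _ (ℱ κ) (s i) (ξ i) _ (hsF κ i h3) (hξF κ i this)
      · by_cases h2 : i = κ
        · simp only [hUdef, h2, if_true]
          have : ¬ ((κ : ℕ) < k) := by simp [hκ]
          simp only [this, if_false]
          exact hsF κ κ le_rfl
        · simp only [hUdef, h1, h2, if_false]
          exact hξF κ i h2
    have hUm : Measurable U := by
      refine measurable_pi_lambda _ fun i => ?_
      by_cases h1 : (i : ℕ) < k
      · simp only [hUdef, h1, if_true]; exact (hsm i).add (hξm i)
      · by_cases h2 : i = κ
        · have : ¬ ((κ : ℕ) < k) := by simp [hκ]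
          simp only [hUdef, h2, this, if_true, if_false]; exact hsm κ
        · simp only [hUdef, h1, h2, if_false]; exact hξm i
    have hI : IndepFun U (ξ κ) P := by
      rw [IndepFun_iff_Indep]
      exact indep_of_indep_of_le_left (hind κ) hUF.comap_le
    have hB : MeasurableSet {q : (Fin m → ℝ) × ℝ | Function.update q.1 κ q.2 ∈ A} :=
      (measurable_update' : Measurable fun q : (Fin m → ℝ) × ℝ => Function.update q.1 κ q.2) hA
    have key := measure_prod_mem_le_of_indepFun_gaussian hv hUm (hξm κ) (hlaw κ) hI
      (measurable_pi_apply κ) hB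
    have hUκ : ∀ ω, U ω κ = s κ ω := fun ω => by simp [hUdef, hκ]
    simp only [Set.mem_ofPred_eq, hUκ] at key
    have e1 : ∀ ω, Function.update (U ω) κ (ξ κ ω) =
        fun i : Fin m => if (i : ℕ) < k then s i ω + ξ i ω else ξ i ω := by
      intro ω; ext i
      by_cases h2 : i = κ
      · subst h2; simp [hκ]
      · simp [hUdef, h2]
    have e2 : ∀ ω, Function.update (U ω) κ (s κ ω + ξ κ ω) =
        fun i : Fin m => if (i : ℕ) < k + 1 then s i ω + ξ i ω else ξ i ω := by
      intro ω; ext i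
      by_cases h2 : i = κ
      · subst h2; simp [hκ]
      · have h3 : (i : ℕ) ≠ k := fun h => h2 (Fin.ext h)
        have h4 : (i : ℕ) < k + 1 ↔ (i : ℕ) < k := by omega
        simp [hUdef, h2, h4]
    simp only [e1, e2] at key
    refine (add_le_add_left key _).trans ?_
    rw [add_assoc]
    push_cast
    rw [add_mul, one_mul, add_comm ((k : ℝ≥0∞) * δ)]
    gcongr
    exact hδ κ

theorem iIndepFun_of_indep_complement {Ω : Type*} [MeasurableSpace Ω] {P : Measure Ω}
    [IsProbabilityMeasure P] {ι : Type*} {ξ : ι → Ω → ℝ} {ℱ : ι → MeasurableSpace Ω}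
    (hξF : ∀ k i, i ≠ k → Measurable[ℱ k] (ξ i))
    (hind : ∀ k, Indep (ℱ k) (MeasurableSpace.comap (ξ k) inferInstance) P) :
    iIndepFun ξ P := by
  classical
  rw [iIndepFun_iff_measure_inter_preimage_eq_mul]
  intro S
  induction S using Finset.induction_on with
  | empty => intro _ _; simp
  | insert k S hk ih =>
    intro B hB
    have ih' := ih (fun i hi => hB i (Finset.mem_insert_of_mem hi))
    rw [Finset.prod_insert hk, Finset.set_biInter_insert, Set.inter_comm,
      (Indep_iff _ _ _).1 (hind k), ih', mul_comm]
    · refine Finset.measurableSet_biInter (m := ℱ k) S fun i hi => ?_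
      exact hξF k i (fun h => hk (h ▸ hi)) (hB i (Finset.mem_insert_of_mem hi))
    · exact ⟨_, hB k (Finset.mem_insert_self _ _), rfl⟩

/-! ### Coverage of the `t` interval for i.i.d. Gaussian samples -/

/-- The tail of Student's `t` distribution beyond its quantile. Neither the continuity of the
distribution nor the sign of the quantile is needed. -/
theorem studentT_Iio_neg_abs_tQuantile_le {a : ℝ} (ha : 0 < a) (ν : ℕ) :
    studentT ν (Set.Iio (-|tQuantile a ν|)) ≤ ENNReal.ofReal a := by
  have hmeas : Measurable fun g : Fin (ν + 1) → ℝ =>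
      g 0 / √((∑ i : Fin ν, g i.succ ^ 2) / ν) := by
    fun_prop
  have : IsProbabilityMeasure (studentT ν) :=
    Measure.isProbabilityMeasure_map hmeas.aemeasurable
  set q := tQuantile a ν
  have hbdd : BddBelow {x : ℝ | a ≤ (studentT ν).real (Set.Iic x)} := by
    have h := (tendsto_cdf_atBot (studentT ν)).eventually (gt_mem_nhds ha)
    obtain ⟨b, hb⟩ := h.exists
    refine ⟨b, fun x hx => ?_⟩
    by_contra! hlt
    rw [cdf_eq_real] at hb
    have : (studentT ν).real (Set.Iic x) ≤ (studentT ν).real (Set.Iic b) :=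
      measureReal_mono (Set.Iic_subset_Iic.2 hlt.le)
    exact absurd (hx.trans this) (not_le.2 hb)
  -- Boundedness below matters: the infimum of an unbounded set of reals is the junk value `0`.
  have hlt : ∀ x < q, studentT ν (Set.Iic x) ≤ ENNReal.ofReal a := by
    intro x hx
    have hnot : ¬ a ≤ (studentT ν).real (Set.Iic x) := fun h =>
      absurd (csInf_le hbdd h) (not_le.2 hx)
    rw [← ENNReal.ofReal_toReal (measure_ne_top (studentT ν) (Set.Iic x))]
    exact ENNReal.ofReal_le_ofReal (not_le.1 hnot).le
  have hsub : Set.Iio (-|q|) ⊆ ⋃ n : ℕ, Set.Iic (q - 1 / ((n : ℝ) + 1)) := by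
    intro x hx
    have hxq : x < q := lt_of_lt_of_le hx (neg_abs_le q)
    obtain ⟨n, hn⟩ := exists_nat_one_div_lt (sub_pos.2 hxq)
    exact Set.mem_iUnion.2 ⟨n, by simp only [Set.mem_Iic]; linarith⟩
  refine (measure_mono hsub).trans ?_
  have hmono : Monotone fun n : ℕ => Set.Iic (q - 1 / ((n : ℝ) + 1)) := by
    intro n k hnk
    apply Set.Iic_subset_Iic.2
    have : 1 / ((k : ℝ) + 1) ≤ 1 / ((n : ℝ) + 1) :=
      one_div_le_one_div_of_le (by positivity) (by gcongr)
    linarith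
  rw [hmono.measure_iUnion]
  refine iSup_le fun n => hlt _ ?_
  have : 0 < 1 / ((n : ℝ) + 1) := by positivity
  linarith

theorem map_neg_pi_gaussianReal (m : ℕ) :
    (Measure.pi fun _ : Fin m => gaussianReal 0 1).map (fun x i => -x i) =
      Measure.pi fun _ : Fin m => gaussianReal 0 1 := by
  have := Measure.pi_map_pi (μ := fun _ : Fin m => gaussianReal 0 1)
    (f := fun _ x => -x) (fun _ => by fun_prop)
  simpa [gaussianReal_map_neg] using this

theorem studentT_Ioi_eq (ν : ℕ) (x : ℝ) :
    studentT ν (Set.Ioi x) = studentT ν (Set.Iio (-x)) := by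
  have hmeas : Measurable fun g : Fin (ν + 1) → ℝ =>
      g 0 / √((∑ i : Fin ν, g i.succ ^ 2) / ν) := by
    fun_prop
  rw [studentT, Measure.map_apply hmeas measurableSet_Ioi,
    Measure.map_apply hmeas measurableSet_Iio]
  conv_lhs => rw [← map_neg_pi_gaussianReal, Measure.map_apply (by fun_prop)
    (hmeas measurableSet_Ioi)]
  congr 1
  ext g
  simp only [Set.mem_preimage, Set.mem_Ioi, Set.mem_Iio, neg_sq, neg_div]
  exact lt_neg

/-- An orthogonal transformation whose first coordinate is `√m` times the sample mean: the
reflection that exchanges the normalised all-ones vector and the first basis vector. -/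
theorem exists_linearIsometryEquiv_zero_eq (m : ℕ) [NeZero m] :
    ∃ f : EuclideanSpace ℝ (Fin m) ≃ₗᵢ[ℝ] EuclideanSpace ℝ (Fin m),
      ∀ g, f g 0 = √m * ((m : ℝ)⁻¹ * ∑ i, g i) := by
  have hm : (0 : ℝ) < m := by exact_mod_cast NeZero.pos m
  set u : EuclideanSpace ℝ (Fin m) := WithLp.toLp 2 fun _ => (√(m : ℝ))⁻¹ with hu
  set e : EuclideanSpace ℝ (Fin m) := EuclideanSpace.single 0 1 with he
  have hnu : ‖u‖ = ‖e‖ := by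
    rw [he, PiLp.norm_single, norm_one, EuclideanSpace.norm_eq]
    simp [hu, hm.le, hm.ne']
  refine ⟨(ℝ ∙ (u - e))ᗮ.reflection, fun g => ?_⟩
  have h1 : (ℝ ∙ (u - e))ᗮ.reflection u = e := Submodule.reflection_sub hnu
  have h2 := (ℝ ∙ (u - e))ᗮ.reflection.inner_map_map u g
  rw [h1, he, EuclideanSpace.inner_single_left] at h2
  simp only [map_one, one_mul] at h2
  rw [h2, PiLp.inner_apply]
  simp only [hu, RCLike.inner_apply, conj_trivial, ← Finset.sum_mul]
  have := Real.mul_self_sqrt hm.le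
  have h3 : 0 < √(m : ℝ) := Real.sqrt_pos.2 hm
  field_simp
  rw [sq, this]

theorem sum_sub_mean_sq {m : ℕ} (hm : m ≠ 0) (x : Fin m → ℝ) :
    ∑ i, (x i - (m : ℝ)⁻¹ * ∑ k, x k) ^ 2 = ∑ i, x i ^ 2 - m * ((m : ℝ)⁻¹ * ∑ k, x k) ^ 2 := by
  have : (m : ℝ) ≠ 0 := by exact_mod_cast hm
  simp only [sub_sq, Finset.sum_add_distrib, Finset.sum_sub_distrib, Finset.sum_const,
    Finset.card_univ, Fintype.card_fin, nsmul_eq_mul, ← Finset.sum_mul, ← Finset.mul_sum]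
  field_simp
  ring

/-- The samples whose two-sided confidence interval, built from the quantile `q`, covers zero. -/
def coverSet (m : ℕ) (q : ℝ) : Set (Fin m → ℝ) :=
  {x | |(m : ℝ)⁻¹ * ∑ i, x i| ≤ |q| *
    (√(((m : ℝ) - 1)⁻¹ * ∑ i, (x i - (m : ℝ)⁻¹ * ∑ k, x k) ^ 2) / √m)}

theorem measurableSet_coverSet (m : ℕ) (q : ℝ) : MeasurableSet (coverSet m q) := by
  unfold coverSet
  exact measurableSet_le (by fun_prop) (by fun_prop)

theorem smul_mem_coverSet {m : ℕ} {q c : ℝ} (hc : 0 < c) (x : Fin m → ℝ) :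
    (fun i => c * x i) ∈ coverSet m q ↔ x ∈ coverSet m q := by
  simp only [coverSet, Set.mem_ofPred_eq, ← Finset.mul_sum]
  have e : ∀ i, (c * x i - (m : ℝ)⁻¹ * (c * ∑ k, x k)) ^ 2 =
      c ^ 2 * (x i - (m : ℝ)⁻¹ * ∑ k, x k) ^ 2 := fun i => by ring
  simp only [e, ← Finset.mul_sum]
  rw [mul_left_comm, abs_mul, abs_of_pos hc, mul_left_comm _ (c ^ 2), Real.sqrt_mul (sq_nonneg c),
    Real.sqrt_sq hc.le, mul_div_assoc, mul_left_comm |q| c]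
  exact mul_le_mul_iff_right₀ hc

/-- After an orthogonal transformation that takes `√m` times the sample mean to the first
coordinate, the sum of squares of the other coordinates is the sum of squared deviations, so that
the studentised mean has exactly the `t` distribution with `ν` degrees of freedom. -/
theorem pi_gaussianReal_one_compl_coverSet_le {ν : ℕ} (hν : ν ≠ 0) {α : ℝ} (hα : 0 < α) :
    (Measure.pi fun _ : Fin (ν + 1) => gaussianReal 0 1)
      (coverSet (ν + 1) (tQuantile (α / 2) ν))ᶜ ≤ ENNReal.ofReal α := by
  set μ := Measure.pi fun _ : Fin (ν + 1) => gaussianReal 0 1 with hμ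
  set q := tQuantile (α / 2) ν
  obtain ⟨f, hf⟩ := exists_linearIsometryEquiv_zero_eq (ν + 1)
  set S : (Fin (ν + 1) → ℝ) → ℝ := fun g => √((∑ i : Fin ν, g i.succ ^ 2) / ν) with hS
  have hSm : Measurable S := by fun_prop
  have hmeas : Measurable (fun g : Fin (ν + 1) → ℝ => g 0 / S g) := by fun_prop
  set F : (Fin (ν + 1) → ℝ) → (Fin (ν + 1) → ℝ) := fun g => (f (WithLp.toLp 2 g)).ofLp with hF
  have hFm : Measurable F := by fun_prop
  have hmap : μ.map F = μ := by
    have h1 := map_pi_eq_stdGaussian (ι := Fin (ν + 1))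
    have h2 := stdGaussian_map f
    have h3 : μ = (stdGaussian (EuclideanSpace ℝ (Fin (ν + 1)))).map WithLp.ofLp := by
      rw [← h1, Measure.map_map (by fun_prop) (by fun_prop)]
      exact Measure.map_id.symm
    conv_rhs => rw [h3, ← h2, ← h1, Measure.map_map (by fun_prop) (by fun_prop),
      Measure.map_map (by fun_prop) (by fun_prop)]
    rfl
  have hnpos : (0 : ℝ) < ((ν + 1 : ℕ) : ℝ) := by positivity
  have hsq := Real.sqrt_pos.2 hnpos
  have hA : (coverSet (ν + 1) q)ᶜ = F ⁻¹' {h | ¬ |h 0| ≤ |q| * S h} := by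
    ext g
    have h0 : F g 0 = √((ν + 1 : ℕ) : ℝ) * ((((ν + 1 : ℕ) : ℝ))⁻¹ * ∑ i, g i) := hf _
    have hn : ∑ i, F g i ^ 2 = ∑ i, g i ^ 2 := by
      have h1 := f.norm_map (WithLp.toLp 2 g)
      have h2 := EuclideanSpace.real_norm_sq_eq (f (WithLp.toLp 2 g))
      rw [h1, EuclideanSpace.real_norm_sq_eq] at h2
      exact h2.symm
    have hs : ∑ i : Fin ν, F g i.succ ^ 2 =
        ∑ i, (g i - (((ν + 1 : ℕ) : ℝ))⁻¹ * ∑ k, g k) ^ 2 := by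
      rw [sum_sub_mean_sq (by omega), ← hn, Fin.sum_univ_succ, h0, mul_pow,
        Real.sq_sqrt hnpos.le]
      ring
    simp only [coverSet, Set.mem_compl_iff, Set.mem_preimage, Set.mem_ofPred_eq, hS, hs, h0,
      abs_mul (√((ν + 1 : ℕ) : ℝ)), abs_of_pos hsq]
    rw [← mul_div_assoc, le_div_iff₀ hsq, mul_comm (√((ν + 1 : ℕ) : ℝ))]
    simp [div_eq_inv_mul]
  have hgood : MeasurableSet {h : Fin (ν + 1) → ℝ | |h 0| ≤ |q| * S h} :=
    measurableSet_le (by fun_prop) (by fun_prop)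
  have hbad : MeasurableSet {h : Fin (ν + 1) → ℝ | ¬ |h 0| ≤ |q| * S h} := hgood.compl
  rw [hA, ← Measure.map_apply hFm hbad, hmap]
  -- Where `S` vanishes, `h 0 / S h` is the junk value `0`; this happens with probability zero.
  have hzero : μ {h | S h = 0} = 0 := by
    have hsub : {h | S h = 0} ⊆ (Function.eval (1 : Fin (ν + 1))) ⁻¹' ({0} : Set ℝ) := by
      intro h hh
      obtain ⟨k, rfl⟩ := Nat.exists_eq_succ_of_ne_zero hν
      have hpos : (0 : ℝ) < ((k.succ : ℕ) : ℝ) := by positivity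
      have hnn : 0 ≤ ∑ i : Fin k.succ, h i.succ ^ 2 :=
        Finset.sum_nonneg fun i _ => sq_nonneg _
      simp only [hS, Set.mem_ofPred_eq, Real.sqrt_eq_zero (div_nonneg hnn hpos.le),
        div_eq_zero_iff, hpos.ne', or_false] at hh
      have := (Finset.sum_eq_zero_iff_of_nonneg (fun i _ => sq_nonneg _)).1 hh 0
        (Finset.mem_univ _)
      simpa using this
    refine measure_mono_null hsub ?_
    have hmp := measurePreserving_eval (fun _ : Fin (ν + 1) => gaussianReal 0 1) 1
    rw [hmp.measure_preimage (measurableSet_singleton _).nullMeasurableSet]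
    have := nullSingletonClass_gaussianReal (μ := 0) (v := 1) one_ne_zero
    exact measure_singleton 0
  have hsub : {h : Fin (ν + 1) → ℝ | ¬ |h 0| ≤ |q| * S h} ⊆ {h | S h = 0} ∪
      ((fun g => g 0 / S g) ⁻¹' Set.Iio (-|q|) ∪ (fun g => g 0 / S g) ⁻¹' Set.Ioi |q|) := by
    intro h hh
    have hS0 : 0 ≤ S h := Real.sqrt_nonneg _
    rcases hS0.eq_or_lt with h0 | h0
    · exact Or.inl h0.symm
    · right
      simp only [Set.mem_ofPred_eq, not_le] at hh
      rcases lt_abs.1 hh with h1 | h1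
      · exact Or.inr ((lt_div_iff₀ h0).2 h1)
      · exact Or.inl ((div_lt_iff₀ h0).2 (by linarith))
  have hIio : μ ((fun g => g 0 / S g) ⁻¹' Set.Iio (-|q|)) ≤ ENNReal.ofReal (α / 2) := by
    rw [← Measure.map_apply hmeas measurableSet_Iio]
    exact studentT_Iio_neg_abs_tQuantile_le (half_pos hα) ν
  have hIoi : μ ((fun g => g 0 / S g) ⁻¹' Set.Ioi |q|) ≤ ENNReal.ofReal (α / 2) := by
    rw [← Measure.map_apply hmeas measurableSet_Ioi]
    exact (studentT_Ioi_eq ν |q|).le.trans (studentT_Iio_neg_abs_tQuantile_le (half_pos hα) ν)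
  calc μ _ ≤ μ {h | S h = 0} + (μ ((fun g => g 0 / S g) ⁻¹' Set.Iio (-|q|)) +
        μ ((fun g => g 0 / S g) ⁻¹' Set.Ioi |q|)) :=
        (measure_mono hsub).trans ((measure_union_le _ _).trans
          (add_le_add le_rfl (measure_union_le _ _)))
    _ ≤ 0 + (ENNReal.ofReal (α / 2) + ENNReal.ofReal (α / 2)) := by
        rw [hzero]; gcongr
    _ = ENNReal.ofReal α := by
        rw [zero_add, ← ENNReal.ofReal_add (by positivity) (by positivity), add_halves]

theorem one_sub_le_pi_gaussianReal_coverSet {m : ℕ} (hm : 2 ≤ m) {α : ℝ} (hα : 0 < α)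
    {v : NNReal} (hv : v ≠ 0) :
    1 - α ≤ (Measure.pi fun _ : Fin m => gaussianReal 0 v).real
      (coverSet m (tQuantile (α / 2) (m - 1))) := by
  obtain ⟨ν, rfl⟩ : ∃ ν, m = ν + 1 := ⟨m - 1, by omega⟩
  rw [Nat.add_sub_cancel]
  set q := tQuantile (α / 2) ν
  have hv' : 0 < √(v : ℝ) := Real.sqrt_pos.2 (by positivity)
  have hscale : (Measure.pi fun _ : Fin (ν + 1) => gaussianReal 0 v) =
      (Measure.pi fun _ : Fin (ν + 1) => gaussianReal 0 1).map (fun x i => √v * x i) := by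
    have h := Measure.pi_map_pi (μ := fun _ : Fin (ν + 1) => gaussianReal 0 1)
      (f := fun _ x => √(v : ℝ) * x) (fun _ => by fun_prop)
    rw [h]
    congr 1
    funext i
    rw [gaussianReal_map_const_mul]
    congr 1
    · simp
    · ext; simp
  have hpre : (fun (x : Fin (ν + 1) → ℝ) i => √(v : ℝ) * x i) ⁻¹' coverSet (ν + 1) q =
      coverSet (ν + 1) q := by
    ext x; exact smul_mem_coverSet hv' x
  rw [hscale, map_measureReal_apply (by fun_prop) (measurableSet_coverSet _ _), hpre]
  have h := pi_gaussianReal_one_compl_coverSet_le (ν := ν) (by omega) hα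
  have h2 := prob_compl_eq_one_sub (μ := Measure.pi fun _ : Fin (ν + 1) => gaussianReal 0 1)
    (measurableSet_coverSet (ν + 1) q)
  have h3 := probReal_compl_eq_one_sub (μ := Measure.pi fun _ : Fin (ν + 1) => gaussianReal 0 1)
    (measurableSet_coverSet (ν + 1) q)
  have h4 : (Measure.pi fun _ : Fin (ν + 1) => gaussianReal 0 1).real
      (coverSet (ν + 1) q)ᶜ ≤ α :=
    ENNReal.toReal_le_of_le_ofReal hα.le h
  linarith

/-! ### Least squares and the error recursion -/

theorem opOf_empCov_apply {n p : ℕ} (X : Matrix (Fin n) (Fin p) ℝ) (v : Vec p) :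
    opOf (empCov X) v =
      (n : ℝ)⁻¹ • ∑ i, (inner ℝ (covariate X i) v : ℝ) • covariate X i := by
  ext j
  simp only [opOf, empCov, map_smul, smul_apply, PiLp.smul_apply, smul_eq_mul,
    Matrix.ofLp_toEuclideanCLM, WithLp.ofLp_sum, WithLp.ofLp_smul, Finset.sum_apply, Pi.smul_apply,
    covariate]
  congr 1
  rw [← Matrix.mulVec_mulVec, Matrix.mulVec, dotProduct]
  refine Finset.sum_congr rfl fun i _ => ?_
  rw [PiLp.inner_apply, mul_comm, Matrix.transpose_apply, Matrix.mulVec, dotProduct]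
  congr 1
  exact Finset.sum_congr rfl fun k _ => by simp [mul_comm]

theorem inner_opOf_empCov_self {n p : ℕ} (X : Matrix (Fin n) (Fin p) ℝ) (v : Vec p) :
    (inner ℝ v (opOf (empCov X) v) : ℝ) =
      (n : ℝ)⁻¹ * ∑ i, (inner ℝ (covariate X i) v : ℝ) ^ 2 := by
  rw [opOf_empCov_apply, inner_smul_right, inner_sum]
  congr 1
  refine Finset.sum_congr rfl fun i _ => ?_
  rw [inner_smul_right, real_inner_comm, sq]

theorem half_norm_sq_le_inner_opOf_empCov {n p : ℕ} {X : Matrix (Fin n) (Fin p) ℝ}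
    (h : (empCov X - (1 / 2 : ℝ) • (1 : Matrix (Fin p) (Fin p) ℝ)).PosSemidef) (v : Vec p) :
    1 / 2 * ‖v‖ ^ 2 ≤ inner ℝ v (opOf (empCov X) v) := by
  have h1 := h.dotProduct_mulVec_nonneg v.ofLp
  have h2 : (inner ℝ v (opOf (empCov X - (1 / 2 : ℝ) • (1 : Matrix (Fin p) (Fin p) ℝ)) v) : ℝ) =
      star v.ofLp ⬝ᵥ (empCov X - (1 / 2 : ℝ) • (1 : Matrix (Fin p) (Fin p) ℝ)).mulVec v.ofLp := by
    rw [EuclideanSpace.inner_eq_star_dotProduct, Matrix.ofLp_toEuclideanCLM, dotProduct_comm]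
  rw [← h2] at h1
  simp only [opOf, map_sub, map_smul, map_one, sub_apply,
    smul_apply, one_apply_eq_self, inner_sub_right,
    inner_smul_right, real_inner_self_eq_norm_sq] at h1
  simp only [opOf]
  linarith

theorem norm_le_two_mul_norm_opOf_empCov {n p : ℕ} {X : Matrix (Fin n) (Fin p) ℝ}
    (h : (empCov X - (1 / 2 : ℝ) • (1 : Matrix (Fin p) (Fin p) ℝ)).PosSemidef) (v : Vec p) :
    ‖v‖ ≤ 2 * ‖opOf (empCov X) v‖ := by
  have h1 := half_norm_sq_le_inner_opOf_empCov h v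
  have h2 := real_inner_le_norm v (opOf (empCov X) v)
  rcases (norm_nonneg v).eq_or_lt with h0 | h0
  · rw [← h0]; positivity
  · nlinarith

theorem opOf_empCov_olsSolution {n p : ℕ} {X : Matrix (Fin n) (Fin p) ℝ}
    (h : (empCov X - (1 / 2 : ℝ) • (1 : Matrix (Fin p) (Fin p) ℝ)).PosSemidef)
    (y : Fin n → ℝ) :
    opOf (empCov X) (olsSolution X y) = (n : ℝ)⁻¹ • ∑ i, y i • covariate X i := by
  have hinj : Function.Injective (X.transpose * X).mulVec := by
    intro a b hab
    have h1 := norm_le_two_mul_norm_opOf_empCov h (WithLp.toLp 2 (a - b))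
    have h2 : opOf (empCov X) (WithLp.toLp 2 (a - b)) = 0 := by
      simp only [opOf, empCov, map_smul, smul_apply,
        Matrix.toEuclideanCLM_toLp, Matrix.mulVec_sub, hab, sub_self]
      simp
    rw [h2, norm_zero, mul_zero] at h1
    have h3 := norm_le_zero_iff.1 h1
    exact sub_eq_zero.1 (congrArg WithLp.ofLp h3)
  have hdet : IsUnit (X.transpose * X).det :=
    (Matrix.isUnit_iff_isUnit_det _).1 (Matrix.mulVec_injective_iff_isUnit.1 hinj)
  ext j
  simp only [opOf, empCov, map_smul, smul_apply, PiLp.smul_apply, smul_eq_mul,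
    olsSolution, Matrix.ofLp_toEuclideanCLM, WithLp.ofLp_sum, WithLp.ofLp_smul, Finset.sum_apply,
    Pi.smul_apply, covariate]
  congr 1
  rw [Matrix.mulVec_mulVec, ← Matrix.mul_assoc, Matrix.mul_nonsing_inv _ hdet, Matrix.one_mul]
  simp [Matrix.mulVec, dotProduct, mul_comm]

/-- Without clipping, the averaged gradient is linear in the error `θ - θ̂`. -/
theorem clippedGradient_top {n p : ℕ} {X : Matrix (Fin n) (Fin p) ℝ}
    (h : (empCov X - (1 / 2 : ℝ) • (1 : Matrix (Fin p) (Fin p) ℝ)).PosSemidef)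
    (y : Fin n → ℝ) (θ : Vec p) :
    clippedGradient X y ⊤ θ = opOf (empCov X) (θ - olsSolution X y) := by
  rw [map_sub, opOf_empCov_olsSolution h, opOf_empCov_apply, clippedGradient, ← smul_sub,
    ← Finset.sum_sub_distrib]
  congr 1
  refine Finset.sum_congr rfl fun i _ => ?_
  rw [clip_top, sub_smul, neg_sub]

/-- The accumulated noise of the affine recursion `x ↦ M x + η w` started at zero, where the
step to time `t + 1` uses `w t`. -/
noncomputable def noiseSum {p : ℕ} (M : Vec p →L[ℝ] Vec p) (η : ℝ) (w : ℕ → Vec p) : ℕ → Vec p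
  | 0 => 0
  | t + 1 => M (noiseSum M η w t) + η • w t

theorem dpgdIterate_succ_sub_olsSolution {n p : ℕ} {X : Matrix (Fin n) (Fin p) ℝ}
    (h : (empCov X - (1 / 2 : ℝ) • (1 : Matrix (Fin p) (Fin p) ℝ)).PosSemidef)
    (y : Fin n → ℝ) (η : ℝ) (θ₀ : Vec p) (z : ℕ → Vec p) (t : ℕ) :
    dpgdIterate X y ⊤ η θ₀ z (t + 1) - olsSolution X y =
      opOf (1 - η • empCov X) (dpgdIterate X y ⊤ η θ₀ z t - olsSolution X y) + η • z (t + 1) := by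
  rw [dpgdIterate, clippedGradient_top h]
  simp only [opOf, map_sub, map_smul, map_one, sub_apply,
    smul_apply, one_apply_eq_self]
  module

/-- Restarting the recursion at time `a`: the error `t` steps later is the contracted error at
time `a` plus the noise accumulated in between. -/
theorem dpgdIterate_add_sub_olsSolution {n p : ℕ} {X : Matrix (Fin n) (Fin p) ℝ}
    (h : (empCov X - (1 / 2 : ℝ) • (1 : Matrix (Fin p) (Fin p) ℝ)).PosSemidef)
    (y : Fin n → ℝ) (η : ℝ) (θ₀ : Vec p) (z : ℕ → Vec p) (a t : ℕ) :
    dpgdIterate X y ⊤ η θ₀ z (a + t) - olsSolution X y =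
      (opOf (1 - η • empCov X) ^ t) (dpgdIterate X y ⊤ η θ₀ z a - olsSolution X y) +
        noiseSum (opOf (1 - η • empCov X)) η (fun i => z (a + i + 1)) t := by
  induction t with
  | zero => simp [noiseSum]
  | succ t ih =>
    rw [← add_assoc, dpgdIterate_succ_sub_olsSolution h, ih, map_add, noiseSum, pow_succ',
      mul_apply_eq_comp, add_assoc]

/-- The parameter `θ` of the No-Clipping Condition itself may be unbounded when
`I - ηΣ` is singular; its image under `I - ηΣ` is not, by the case `t = 1` of the condition. -/
theorem NoClippingCondition.norm_step_initial_error_le {n p : ℕ} {X : Matrix (Fin n) (Fin p) ℝ}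
    {y : Fin n → ℝ} {σ η c₀ R : ℝ} {N : ℕ} (hN : 1 ≤ N) (hc : NoClippingCondition X y σ η c₀ N)
    {θ₀ : Vec p} (hθ₀ : ‖θ₀‖ ≤ R) (hσ : 0 ≤ σ) :
    ‖opOf (1 - η • empCov X) (θ₀ - olsSolution X y)‖ ≤ R + 2 * c₀ ^ 2 * σ * √p + 2 * |c₀| := by
  obtain ⟨hlow, -, hM, θ, hθ⟩ := hc
  set M := opOf (1 - η • empCov X) with hMdef
  have h1 : ∀ i, ‖covariate X i‖ ≤ c₀ * √p ∧ |y i - inner ℝ (covariate X i) θ| ≤ c₀ * σ ∧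
      |(inner ℝ (covariate X i) (M θ) : ℝ)| ≤ c₀ := by
    intro i
    obtain ⟨a, b, c, -⟩ := hθ i 1 (Finset.mem_Icc.2 ⟨le_rfl, hN⟩)
    rw [pow_one] at c
    exact ⟨a, b, c⟩
  have havg : ∀ (f : Fin n → ℝ) (B : ℝ), 0 ≤ B → (∀ i, f i ≤ B) → (n : ℝ)⁻¹ * ∑ i, f i ≤ B := by
    intro f B hB hf
    rcases Nat.eq_zero_or_pos n with rfl | hn
    · simpa using hB
    · have hn' : (0 : ℝ) < n := by exact_mod_cast hn
      rw [inv_mul_le_iff₀ hn']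
      simpa using Finset.sum_le_sum fun i (_ : i ∈ Finset.univ) => hf i
  have hMθ : ‖M θ‖ ≤ 2 * |c₀| := by
    have h2 := half_norm_sq_le_inner_opOf_empCov hlow (M θ)
    rw [inner_opOf_empCov_self] at h2
    have h3 := havg (fun i => (inner ℝ (covariate X i) (M θ) : ℝ) ^ 2) (c₀ ^ 2) (sq_nonneg _)
      fun i => by rw [← sq_abs]; exact pow_le_pow_left₀ (abs_nonneg _) (h1 i).2.2 2
    refine abs_le_of_sq_le_sq' ?_ (by positivity) |>.2
    rw [mul_pow, sq_abs]
    nlinarith [sq_nonneg c₀]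
  have hdiff : ‖θ - olsSolution X y‖ ≤ 2 * c₀ ^ 2 * σ * √p := by
    have h2 := norm_le_two_mul_norm_opOf_empCov hlow (θ - olsSolution X y)
    rw [← clippedGradient_top hlow, clippedGradient, norm_smul, norm_inv, RCLike.norm_natCast] at h2
    have h3 : ∀ i, ‖clip ⊤ (-((y i - inner ℝ (covariate X i) θ) • covariate X i))‖ ≤
        c₀ ^ 2 * σ * √p := by
      intro i
      rw [clip_top, norm_neg, norm_smul, Real.norm_eq_abs]
      calc _ ≤ (c₀ * σ) * (c₀ * √p) :=
            mul_le_mul (h1 i).2.1 (h1 i).1 (norm_nonneg _) ((abs_nonneg _).trans (h1 i).2.1)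
        _ = _ := by ring
    have h4 := havg _ _ (by positivity) h3
    have h5 : (n : ℝ)⁻¹ * ‖∑ i, clip ⊤ (-((y i - inner ℝ (covariate X i) θ) • covariate X i))‖ ≤
        c₀ ^ 2 * σ * √p := (mul_le_mul_of_nonneg_left (norm_sum_le _ _) (by positivity)).trans h4
    linarith
  have hcontr : ∀ v, ‖M v‖ ≤ ‖v‖ := fun v =>
    (M.le_of_opNorm_le hM v).trans (by nlinarith [norm_nonneg v])
  -- The error splits into the start, the parameter `θ`, and the fit residual of `θ`.
  have hsplit : M (θ₀ - olsSolution X y) = M θ₀ - M θ + M (θ - olsSolution X y) := by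
    simp only [map_sub]; abel
  rw [hsplit]
  have h5 := norm_add_le (M θ₀ - M θ) (M (θ - olsSolution X y))
  have h6 := norm_sub_le (M θ₀) (M θ)
  have h7 := hcontr θ₀
  have h8 := hcontr (θ - olsSolution X y)
  linarith

/-! ### Law and mean size of the accumulated noise -/

theorem map_inner_multivariateGaussian {p : ℕ} (lam : ℝ) (a : Vec p) :
    (multivariateGaussian 0 ((lam ^ 2) • (1 : Matrix (Fin p) (Fin p) ℝ))).map
      (fun x => (inner ℝ a x : ℝ)) = gaussianReal 0 (lam ^ 2 * ‖a‖ ^ 2).toNNReal := by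
  have hS : ((lam ^ 2) • (1 : Matrix (Fin p) (Fin p) ℝ)).PosSemidef :=
    Matrix.PosSemidef.one.smul (sq_nonneg lam)
  have h := IsGaussian.map_eq_gaussianReal
    (μ := multivariateGaussian 0 ((lam ^ 2) • (1 : Matrix (Fin p) (Fin p) ℝ))) (innerSL ℝ a)
  have e : (⇑(innerSL ℝ a) : Vec p → ℝ) = fun x => (inner ℝ a x : ℝ) := rfl
  rw [ContinuousLinearMap.integral_comp_id_comm IsGaussian.integrable_id,
    integral_id_multivariateGaussian, map_zero, e, ← covariance_self (by fun_prop),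
    ← covarianceBilin_apply_eq_cov IsGaussian.memLp_two_id,
    covarianceBilin_multivariateGaussian hS] at h
  rw [h, Matrix.smul_mulVec, Matrix.one_mulVec, dotProduct_smul, EuclideanSpace.real_norm_sq_eq]
  simp [dotProduct, sq]

theorem lintegral_norm_multivariateGaussian_le {p : ℕ} {lam : ℝ} (hlam : 0 ≤ lam) :
    ∫⁻ x, ENNReal.ofReal ‖x‖ ∂(multivariateGaussian 0 ((lam ^ 2) •
      (1 : Matrix (Fin p) (Fin p) ℝ))) ≤ ENNReal.ofReal (p * lam) := by
  set μ := multivariateGaussian 0 ((lam ^ 2) • (1 : Matrix (Fin p) (Fin p) ℝ))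
  have hcoord : ∀ i : Fin p, ∫⁻ x, ENNReal.ofReal |x i| ∂μ ≤ ENNReal.ofReal lam := by
    intro i
    have hl := map_inner_multivariateGaussian lam (EuclideanSpace.single i (1 : ℝ))
    simp only [EuclideanSpace.inner_single_left, PiLp.norm_single, map_one, one_mul, norm_one,
      one_pow, mul_one] at hl
    rw [← lintegral_map (f := fun t : ℝ => ENNReal.ofReal |t|) (g := fun x : Vec p => x i)
      (by fun_prop) (by fun_prop), hl]
    have hi : Integrable (fun x : ℝ => x) (gaussianReal 0 (lam ^ 2).toNNReal) :=
      (memLp_id_gaussianReal' 1 (by simp)).integrable le_rfl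
    rw [← ofReal_integral_eq_lintegral_ofReal hi.abs (.of_forall fun x => abs_nonneg x)]
    refine ENNReal.ofReal_le_ofReal (integral_abs_gaussianReal_le.trans_eq ?_)
    rw [Real.coe_toNNReal _ (sq_nonneg _), Real.sqrt_sq hlam]
  calc ∫⁻ x, ENNReal.ofReal ‖x‖ ∂μ ≤ ∫⁻ x, ∑ i, ENNReal.ofReal |x i| ∂μ := by
        refine lintegral_mono fun x => ?_
        rw [← ENNReal.ofReal_sum_of_nonneg fun i _ => abs_nonneg _]
        apply ENNReal.ofReal_le_ofReal
        rw [EuclideanSpace.norm_eq]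
        refine Real.sqrt_le_iff.2 ⟨Finset.sum_nonneg fun i _ => abs_nonneg _, ?_⟩
        exact Finset.sum_sq_le_sq_sum_of_nonneg fun i _ => abs_nonneg (x i)
    _ = ∑ i, ∫⁻ x, ENNReal.ofReal |x i| ∂μ := lintegral_finsetSum _ fun i _ => by fun_prop
    _ ≤ ∑ _i : Fin p, ENNReal.ofReal lam := Finset.sum_le_sum fun i _ => hcoord i
    _ = ENNReal.ofReal (p * lam) := by
        rw [Finset.sum_const, Finset.card_univ, Fintype.card_fin, nsmul_eq_mul,
          ENNReal.ofReal_mul (by positivity), ENNReal.ofReal_natCast]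

/-- The variance of `⟪a, noiseSum M η w t⟫` when the `w i` are independent with law
`N(0, lam² I)`. -/
noncomputable def noiseVar {p : ℕ} (M : Vec p →L[ℝ] Vec p) (η lam : ℝ) : ℕ → Vec p → NNReal
  | 0, _ => 0
  | t + 1, a => noiseVar M η lam t (M.adjoint a) + (lam ^ 2 * ‖η • a‖ ^ 2).toNNReal

/-- The last noise vector alone contributes variance `(η lam)²`. -/
theorem le_sqrt_noiseVar {p : ℕ} (M : Vec p →L[ℝ] Vec p) (η lam : ℝ) {t : ℕ} (ht : 1 ≤ t)
    {a : Vec p} (ha : ‖a‖ = 1) :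
    η * lam ≤ √(noiseVar M η lam t a) := by
  obtain ⟨t, rfl⟩ : ∃ s, t = s + 1 := ⟨t - 1, by omega⟩
  apply Real.le_sqrt_of_sq_le
  rw [noiseVar, NNReal.coe_add, Real.coe_toNNReal _ (by positivity), norm_smul, ha, mul_one,
    Real.norm_eq_abs, sq_abs]
  have := (noiseVar M η lam t (M.adjoint a)).coe_nonneg
  nlinarith

/-- Stated for an arbitrary σ-algebra on `Ω`, so that it also yields measurability with respect
to the noise vectors of a given set of times. -/
theorem measurable_noiseSum {Ω : Type*} [MeasurableSpace Ω] {p : ℕ} (M : Vec p →L[ℝ] Vec p)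
    (η : ℝ) {w : ℕ → Ω → Vec p} {t : ℕ} (hw : ∀ i < t, Measurable (w i)) :
    Measurable fun ω => noiseSum M η (fun i => w i ω) t := by
  induction t with
  | zero => exact measurable_const
  | succ t ih =>
    have h1 := ih fun i hi => hw i (hi.trans t.lt_succ_self)
    have h2 := hw t t.lt_succ_self
    simp only [noiseSum]
    fun_prop

/-- Stated for an arbitrary σ-algebra on `Ω`, so that it also yields measurability with respect
to the noise vectors of a given set of times. -/
theorem measurable_dpgdIterate_sub_olsSolution {Ω : Type*} [MeasurableSpace Ω] {n p : ℕ}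
    {X : Matrix (Fin n) (Fin p) ℝ}
    (h : (empCov X - (1 / 2 : ℝ) • (1 : Matrix (Fin p) (Fin p) ℝ)).PosSemidef)
    (y : Fin n → ℝ) (η : ℝ) (θ₀ : Vec p) {z : ℕ → Ω → Vec p} {t : ℕ}
    (hz : ∀ i, 1 ≤ i → i ≤ t → Measurable (z i)) :
    Measurable fun ω => dpgdIterate X y ⊤ η θ₀ (fun i => z i ω) t - olsSolution X y := by
  induction t with
  | zero => simp only [dpgdIterate]; exact measurable_const
  | succ t ih =>
    have h1 := ih fun i hi hi' => hz i hi (hi'.trans t.le_succ)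
    have h2 := hz (t + 1) (by omega) le_rfl
    simp only [dpgdIterate_succ_sub_olsSolution h]
    fun_prop

/-- The linear functionals of the accumulated noise are Gaussian, because each noise vector is
independent of the noise accumulated before it. -/
theorem map_inner_noiseSum {Ω : Type*} [MeasurableSpace Ω] {P : Measure Ω}
    [IsProbabilityMeasure P] {p : ℕ} (M : Vec p →L[ℝ] Vec p) (η : ℝ) {lam : ℝ}
    {w : ℕ → Ω → Vec p} (hwm : ∀ i, Measurable (w i)) (hw : IsGaussianNoise P lam w)
    (t : ℕ) (a : Vec p) :
    P.map (fun ω => (inner ℝ a (noiseSum M η (fun i => w i ω) t) : ℝ)) =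
      gaussianReal 0 (noiseVar M η lam t a) := by
  induction t generalizing a with
  | zero =>
    simp [noiseSum, noiseVar, Measure.map_const]
  | succ t ih =>
    have hind : IndepFun (fun ω => noiseSum M η (fun i => w i ω) t) (w t) P := by
      rw [IndepFun_iff_Indep]
      have hI := indep_iSup_of_disjoint (fun i => (hwm i).comap_le) hw.2.iIndep
        (S := {i | i < t}) (T := {t}) (by simp)
      refine indep_of_indep_of_le hI ?_ ?_
      · refine Measurable.comap_le ?_
        refine @measurable_noiseSum Ω (_) p M η w t fun i hi => ?_
        exact Measurable.of_comap_le (le_iSup₂_of_le i hi le_rfl)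
      · exact le_iSup₂_of_le t rfl le_rfl
    have h1 : (fun ω => (inner ℝ a (noiseSum M η (fun i => w i ω) (t + 1)) : ℝ)) =
        (fun ω => (inner ℝ (M.adjoint a) (noiseSum M η (fun i => w i ω) t) : ℝ)) +
          fun ω => (inner ℝ (η • a) (w t ω) : ℝ) := by
      ext ω
      simp only [noiseSum, inner_add_right, Pi.add_apply, ContinuousLinearMap.adjoint_inner_left,
        inner_smul_right, inner_smul_left, conj_trivial]
    have h2 : P.map (fun ω => (inner ℝ (η • a) (w t ω) : ℝ)) =
        gaussianReal 0 (lam ^ 2 * ‖η • a‖ ^ 2).toNNReal := by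
      rw [← map_inner_multivariateGaussian, ← (hw.1 t).map_eq,
        Measure.map_map (by fun_prop) (hwm t)]
      rfl
    rw [h1, gaussianReal_add_gaussianReal_of_indepFun ?_ (ih _) h2, add_zero, noiseVar]
    exact hind.comp (φ := fun x => (inner ℝ (M.adjoint a) x : ℝ))
      (ψ := fun x => (inner ℝ (η • a) x : ℝ)) (by fun_prop) (by fun_prop)

/-- The mean error stays bounded along the whole run: a step contracts it by `7/8` and adds noise
of mean norm at most `η lam p`. The error is measured after one application of `I - ηΣ`, as only
then the initial one is bounded. -/
theorem lintegral_norm_step_error_le {Ω : Type*} [MeasurableSpace Ω] {P : Measure Ω}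
    [IsProbabilityMeasure P] {n p : ℕ} {X : Matrix (Fin n) (Fin p) ℝ}
    (h : (empCov X - (1 / 2 : ℝ) • (1 : Matrix (Fin p) (Fin p) ℝ)).PosSemidef)
    {y : Fin n → ℝ} {η lam B : ℝ} (hη : 0 ≤ η) (hlam : 0 ≤ lam) {θ₀ : Vec p}
    (hM : ‖opOf (1 - η • empCov X)‖ ≤ 7 / 8)
    (hB : ‖opOf (1 - η • empCov X) (θ₀ - olsSolution X y)‖ ≤ B)
    {z : ℕ → Ω → Vec p} (hzm : ∀ i, Measurable (z i)) (hz : IsGaussianNoise P lam z) (t : ℕ) :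
    ∫⁻ ω, ENNReal.ofReal ‖opOf (1 - η • empCov X)
      (dpgdIterate X y ⊤ η θ₀ (fun i => z i ω) t - olsSolution X y)‖ ∂P ≤
      ENNReal.ofReal (B + 7 * (η * lam) * p) := by
  have hB0 : 0 ≤ B := (norm_nonneg _).trans hB
  set M := opOf (1 - η • empCov X) with hMdef
  induction t with
  | zero =>
    simp only [dpgdIterate, lintegral_const, measure_univ, mul_one]
    exact ENNReal.ofReal_le_ofReal (hB.trans (le_add_of_nonneg_right (by positivity)))
  | succ t ih =>
    have hm : Measurable fun ω => dpgdIterate X y ⊤ η θ₀ (fun i => z i ω) t - olsSolution X y :=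
      measurable_dpgdIterate_sub_olsSolution h y η θ₀ fun i _ _ => hzm i
    have hzt : ∫⁻ ω, ENNReal.ofReal ‖z (t + 1) ω‖ ∂P ≤ ENNReal.ofReal (p * lam) := by
      refine le_trans (le_of_eq ?_) (lintegral_norm_multivariateGaussian_le hlam)
      rw [← (hz.1 (t + 1)).map_eq, lintegral_map (by fun_prop) (hzm _)]
    calc _ ≤ ∫⁻ ω, (ENNReal.ofReal (7 / 8) * ENNReal.ofReal ‖M
            (dpgdIterate X y ⊤ η θ₀ (fun i => z i ω) t - olsSolution X y)‖ +
            ENNReal.ofReal (7 / 8 * η) * ENNReal.ofReal ‖z (t + 1) ω‖) ∂P := by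
          refine lintegral_mono fun ω => ?_
          rw [← ENNReal.ofReal_mul (by positivity), ← ENNReal.ofReal_mul (by positivity),
            ← ENNReal.ofReal_add (by positivity) (by positivity)]
          apply ENNReal.ofReal_le_ofReal
          rw [dpgdIterate_succ_sub_olsSolution h, map_add, map_smul]
          refine (norm_add_le _ _).trans (add_le_add (M.le_of_opNorm_le hM _) ?_)
          rw [norm_smul, Real.norm_of_nonneg hη, mul_comm (7 / 8) η, mul_assoc]
          exact mul_le_mul_of_nonneg_left (M.le_of_opNorm_le hM _) hη
      _ = ENNReal.ofReal (7 / 8) * (∫⁻ ω, ENNReal.ofReal ‖M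
            (dpgdIterate X y ⊤ η θ₀ (fun i => z i ω) t - olsSolution X y)‖ ∂P) +
            ENNReal.ofReal (7 / 8 * η) * ∫⁻ ω, ENNReal.ofReal ‖z (t + 1) ω‖ ∂P := by
          rw [lintegral_add_left (by fun_prop), lintegral_const_mul _ (by fun_prop),
            lintegral_const_mul _ (by fun_prop)]
      _ ≤ ENNReal.ofReal (7 / 8) * ENNReal.ofReal (B + 7 * (η * lam) * p) +
            ENNReal.ofReal (7 / 8 * η) * ENNReal.ofReal (p * lam) := by gcongr
      _ ≤ ENNReal.ofReal (B + 7 * (η * lam) * p) := by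
          rw [← ENNReal.ofReal_mul (by positivity), ← ENNReal.ofReal_mul (by positivity),
            ← ENNReal.ofReal_add (by positivity) (by positivity)]
          apply ENNReal.ofReal_le_ofReal
          nlinarith

theorem mem_confInterval_iff {m p : ℕ} (hm : m ≠ 0) {α c : ℝ} {est : Fin m → Vec p} {j : Fin p}
    {x : Fin m → ℝ} (hx : ∀ l, est l j = c + x l) :
    c ∈ confInterval α est j ↔ x ∈ coverSet m (tQuantile (α / 2) (m - 1)) := by
  have hm' : (m : ℝ) ≠ 0 := by exact_mod_cast hm
  have hmean : sampleMean est j = c + (m : ℝ)⁻¹ * ∑ i, x i := by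
    simp only [sampleMean, hx, Finset.sum_add_distrib, Finset.sum_const, Finset.card_univ,
      Fintype.card_fin, nsmul_eq_mul]
    field_simp
  have hsd : sampleSD est j =
      √(((m : ℝ) - 1)⁻¹ * ∑ i, (x i - (m : ℝ)⁻¹ * ∑ k, x k) ^ 2) := by
    simp only [sampleSD, hmean, hx, add_sub_add_left_eq_sub]
  have huIcc : ∀ a d : ℝ, c ∈ Set.uIcc (a - d) (a + d) ↔ |c - a| ≤ |d| := by
    intro a d
    rw [Set.mem_uIcc, abs_le]
    rcases abs_cases d with ⟨hd, hd'⟩ | ⟨hd, hd'⟩ <;> rw [hd] <;> constructor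
    · rintro (⟨h1, h2⟩ | ⟨h1, h2⟩) <;> constructor <;> linarith
    · rintro ⟨h1, h2⟩; left; constructor <;> linarith
    · rintro (⟨h1, h2⟩ | ⟨h1, h2⟩) <;> constructor <;> linarith
    · rintro ⟨h1, h2⟩; right; constructor <;> linarith
  rw [confInterval, huIcc, hmean, hsd, sub_add_cancel_left, abs_neg,
    abs_mul (tQuantile (α / 2) (m - 1)),
    abs_of_nonneg (div_nonneg (Real.sqrt_nonneg _) (Real.sqrt_nonneg _) :
      (0 : ℝ) ≤ √(((m : ℝ) - 1)⁻¹ * ∑ i, (x i - (m : ℝ)⁻¹ * ∑ k, x k) ^ 2) / √m)]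
  rfl

/-! ### Coverage of the estimates -/

/-- Coverage for estimates made of `m` blocks of `T` noisy steps. Block `l` starts from the error
`D l`, uses the noise vectors with indices `idx l 0, …, idx l (T - 1)`, and no other block uses
these; the errors `D 0, …, D l` do not depend on them. -/
theorem one_sub_sub_le_coverage_of_blocks {Ω : Type*} [MeasurableSpace Ω] {P : Measure Ω}
    [IsProbabilityMeasure P] {ι : Type*} {m p T : ℕ} (hm : 2 ≤ m) (hT : 1 ≤ T)
    {M : Vec p →L[ℝ] Vec p} (hM : ‖M‖ ≤ 7 / 8) {η lam α K : ℝ} (hη : 0 < η) (hlam : 0 < lam)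
    (hα : 0 < α) (hK : 0 ≤ K) {z : ι → Ω → Vec p} (hzm : ∀ i, Measurable (z i))
    (hz : IsGaussianNoise P lam z) {idx : Fin m → ℕ → ι}
    (hinj : ∀ l, Function.Injective (idx l))
    (hdisj : ∀ k l, k ≠ l → ∀ i < T, ∀ i' < T, idx k i ≠ idx l i')
    {D : Fin m → Ω → Vec p} (hDm : ∀ l, Measurable (D l))
    (hD : ∀ k l, l ≤ k → Measurable[⨆ r ∈ {r | ∀ i < T, idx k i ≠ r},
      MeasurableSpace.comap (z r) inferInstance] (D l))
    (hDK : ∀ l, ∫⁻ ω, ENNReal.ofReal ‖M (D l ω)‖ ∂P ≤ ENNReal.ofReal K)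
    (c : Vec p) (j : Fin p) {est : Fin m → Ω → Vec p}
    (hest : ∀ l ω, est l ω - c = (M ^ T) (D l ω) +
      noiseSum M η (fun i => z (idx l i) ω) T) :
    1 - α - m * (2 * ((7 / 8) ^ (T - 1) * K) / (η * lam)) ≤
      P.real {ω | c j ∈ confInterval α (fun l => est l ω) j} := by
  classical
  set e : Vec p := EuclideanSpace.single j 1 with he
  have hinner : ∀ x : Vec p, (inner ℝ e x : ℝ) = x j := by
    intro x; rw [he, EuclideanSpace.inner_single_left]; simp
  have hne : ‖e‖ = 1 := by rw [he, PiLp.norm_single, norm_one]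
  set v : NNReal := noiseVar M η lam T e
  have hηlam : 0 < η * lam := mul_pos hη hlam
  have hsv : η * lam ≤ √(v : ℝ) := le_sqrt_noiseVar M η lam hT hne
  have hv : v ≠ 0 := by
    intro h0; rw [h0] at hsv; simp only [NNReal.coe_zero, Real.sqrt_zero] at hsv; linarith
  -- The `j`-th coordinate of `est l` is `c j + s l + ξ l`: a small bias `s l`, determined by the
  -- noise before block `l`, and the fresh noise `ξ l` of the block.
  set ξ : Fin m → Ω → ℝ := fun l ω => noiseSum M η (fun i => z (idx l i) ω) T j with hξ
  set s : Fin m → Ω → ℝ := fun l ω => (M ^ T) (D l ω) j with hs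
  set S : Fin m → Set ι := fun k => {r | ∀ i < T, idx k i ≠ r} with hS
  set ℱ : Fin m → MeasurableSpace Ω := fun k =>
    ⨆ r ∈ S k, MeasurableSpace.comap (z r) inferInstance with hℱ
  have hcoord : Measurable fun x : Vec p => x j := by fun_prop
  have hMT : Measurable fun x : Vec p => (M ^ T) x j := by fun_prop
  have hξm : ∀ l, Measurable (ξ l) := fun l =>
    hcoord.comp (measurable_noiseSum M η fun i _ => hzm _)
  have hsm : ∀ l, Measurable (s l) := fun l => hMT.comp (hDm l)
  have hξF : ∀ k i, i ≠ k → Measurable[ℱ k] (ξ i) := by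
    intro k i hik
    refine hcoord.comp (@measurable_noiseSum Ω (ℱ k) p M η (fun r => z (idx i r)) T fun r hr => ?_)
    exact Measurable.of_comap_le (le_iSup₂_of_le (idx i r)
      (fun r' hr' => hdisj k i hik.symm r' hr' r hr) le_rfl)
  have hsF : ∀ k i, i ≤ k → Measurable[ℱ k] (s i) := fun k i hik => hMT.comp (hD k i hik)
  have hind : ∀ k, Indep (ℱ k) (MeasurableSpace.comap (ξ k) inferInstance) P := by
    intro k
    have hI := indep_iSup_of_disjoint (fun i => (hzm i).comap_le) hz.2.iIndep
      (S := S k) (T := (S k)ᶜ) disjoint_compl_right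
    refine indep_of_indep_of_le_right hI (Measurable.comap_le ?_)
    refine hcoord.comp (@measurable_noiseSum Ω (_) p M η (fun r => z (idx k r)) T fun r hr => ?_)
    exact Measurable.of_comap_le (le_iSup₂_of_le (idx k r) (fun h => h r hr rfl) le_rfl)
  have hlaw : ∀ k, P.map (ξ k) = gaussianReal 0 v := by
    intro k
    rw [← map_inner_noiseSum M η (fun i => hzm (idx k i))
      (⟨fun i => hz.1 _, hz.2.precomp (hinj k)⟩ : IsGaussianNoise P lam fun i => z (idx k i)) T e]
    simp only [hinner, hξ]
  have hδ : ∀ k, ∫⁻ ω, ENNReal.ofReal (2 * |s k ω| / √v) ∂P ≤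
      ENNReal.ofReal (2 * ((7 / 8) ^ (T - 1) * K) / (η * lam)) := by
    intro k
    have hpt : ∀ ω, 2 * |s k ω| / √v ≤
        (2 * (7 / 8) ^ (T - 1) / (η * lam)) * ‖M (D k ω)‖ := by
      intro ω
      have h1 : |s k ω| ≤ (7 / 8) ^ (T - 1) * ‖M (D k ω)‖ := by
        calc |s k ω| ≤ ‖(M ^ T) (D k ω)‖ := PiLp.norm_apply_le ((M ^ T) (D k ω)) j
          _ = ‖(M ^ (T - 1)) (M (D k ω))‖ := by
            rw [← mul_apply_eq_comp, ← pow_succ, Nat.sub_add_cancel hT]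
          _ ≤ ‖M ^ (T - 1)‖ * ‖M (D k ω)‖ := ContinuousLinearMap.le_opNorm _ _
          _ ≤ _ := by
            gcongr
            rcases Nat.eq_zero_or_pos (T - 1) with h0 | h0
            · rw [h0, pow_zero, pow_zero]; exact ContinuousLinearMap.norm_id_le
            · exact (norm_pow_le' M h0).trans (pow_le_pow_left₀ (norm_nonneg _) hM _)
      calc 2 * |s k ω| / √v ≤ 2 * ((7 / 8) ^ (T - 1) * ‖M (D k ω)‖) / (η * lam) := by gcongr
        _ = _ := by ring
    calc _ ≤ ∫⁻ ω, ENNReal.ofReal (2 * (7 / 8) ^ (T - 1) / (η * lam)) *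
          ENNReal.ofReal ‖M (D k ω)‖ ∂P := by
          refine lintegral_mono fun ω => ?_
          rw [← ENNReal.ofReal_mul (by positivity)]
          exact ENNReal.ofReal_le_ofReal (hpt ω)
      _ ≤ ENNReal.ofReal (2 * (7 / 8) ^ (T - 1) / (η * lam)) * ENNReal.ofReal K := by
          have := hDm k
          rw [lintegral_const_mul _ (by fun_prop)]
          gcongr
          exact hDK k
      _ = _ := by
          rw [← ENNReal.ofReal_mul (by positivity)]
          congr 1; ring
  have hcov := one_sub_le_pi_gaussianReal_coverSet hm hα hv
  set A := coverSet m (tQuantile (α / 2) (m - 1)) with hA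
  have hAm : MeasurableSet A := measurableSet_coverSet _ _
  have hξvec : Measurable fun ω => fun i => ξ i ω := measurable_pi_lambda _ hξm
  have hpi : P.map (fun ω => fun i => ξ i ω) = Measure.pi fun _ : Fin m => gaussianReal 0 v := by
    rw [(iIndepFun_of_indep_complement hξF hind).map_fun_eq_pi_map fun i => (hξm i).aemeasurable]
    simp only [hlaw]
  rw [← hpi, map_measureReal_apply hξvec hAm] at hcov
  have hchain := measure_mem_le_measure_add_mem hv hξm hlaw hsm hξF hsF hind hδ hAm
  have hset : {ω | c j ∈ confInterval α (fun l => est l ω) j} =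
      {ω | (fun i => s i ω + ξ i ω) ∈ A} := by
    ext ω
    refine mem_confInterval_iff (by omega) fun l => ?_
    have h1 : est l ω = c + ((M ^ T) (D l ω) + noiseSum M η (fun i => z (idx l i) ω) T) := by
      rw [← hest]; abel
    rw [h1]
    rfl
  rw [hset]
  have hδ0 : 0 ≤ 2 * ((7 / 8) ^ (T - 1) * K) / (η * lam) := by positivity
  have hreal := ENNReal.toReal_mono (by finiteness) hchain
  rw [ENNReal.toReal_add (by finiteness) (by finiteness), ENNReal.toReal_mul,
    ENNReal.toReal_natCast, ENNReal.toReal_ofReal hδ0] at hreal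
  change P.real _ ≤ P.real _ + _ at hreal
  have hcov' : 1 - α ≤ P.real {ω | (fun i => ξ i ω) ∈ A} := hcov
  linarith

/-- The noise vectors are only almost everywhere measurable; replacing them by measurable
versions changes no probability. -/
theorem le_measureReal_of_forall_measurable_noise {Ω : Type*} [MeasurableSpace Ω]
    {P : Measure Ω} {ι : Type*} [Countable ι] {p : ℕ} {lam b : ℝ} {E : (ι → Vec p) → Prop}
    (H : ∀ z : ι → Ω → Vec p, (∀ i, Measurable (z i)) → IsGaussianNoise P lam z →
      b ≤ P.real {ω | E fun i => z i ω})
    {z : ι → Ω → Vec p} (hz : IsGaussianNoise P lam z) : b ≤ P.real {ω | E fun i => z i ω} := by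
  have hae : ∀ i, AEMeasurable (z i) P := fun i => (hz.1 i).aemeasurable
  have h := H (fun i => (hae i).mk (z i)) (fun i => (hae i).measurable_mk)
    ⟨fun i => (hz.1 i).congr (hae i).ae_eq_mk.symm,
      (iIndepFun_congr fun i => (hae i).ae_eq_mk).1 hz.2⟩
  refine h.trans_eq (measureReal_congr ?_)
  filter_upwards [ae_all_iff.2 fun i => (hae i).ae_eq_mk] with ω hω
  have : (fun i => (hae i).mk (z i) ω) = fun i => z i ω := funext fun i => (hω i).symm
  change E _ = E _
  rw [this]

/-- Once `T` is at least a constant times `log (W m p / (η lam β))`, the total cost of the `m`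
biases is at most `β`; the constant `C` bounds the error `K` up to the factor `W p`. The argument
of the logarithm is at least `2`, so that a multiple of it absorbs any constant. -/
theorem bias_le_of_log_le {C W η lam β K : ℝ} {m p T : ℕ} (hC : 1 ≤ C) (hηlam : 0 < η * lam)
    (hβ : β ∈ Set.Ioo (0 : ℝ) 1) (hm : 2 ≤ m) (hp : 1 ≤ p) (hW : η * lam ≤ W)
    (hK : K ≤ C * (W * p))
    (hT : (1 + Real.log (3 * C) / Real.log 2) / Real.log (8 / 7) *
      Real.log (W * m * p / (η * lam * β)) ≤ T) :
    1 ≤ T ∧ m * (2 * ((7 / 8) ^ (T - 1) * K) / (η * lam)) ≤ β := by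
  obtain ⟨hβ0, hβ1⟩ := hβ
  set Q := W * m * p / (η * lam * β) with hQ
  have hm' : (2 : ℝ) ≤ m := by exact_mod_cast hm
  have hp' : (1 : ℝ) ≤ p := by exact_mod_cast hp
  have hW0 : 0 < W := hηlam.trans_le hW
  have hQ2 : 2 ≤ Q := by
    rw [hQ, le_div_iff₀ (by positivity)]
    calc 2 * (η * lam * β) ≤ 2 * (W * 1) := by gcongr
      _ = W * 2 * 1 := by ring
      _ ≤ W * m * p := by gcongr
  have hl2 : 0 < Real.log 2 := Real.log_pos (by norm_num)
  have hl8 : 0 < Real.log (8 / 7) := Real.log_pos (by norm_num)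
  have hlC : 0 < Real.log (3 * C) := Real.log_pos (by linarith)
  have hlQ : Real.log 2 ≤ Real.log Q := Real.log_le_log (by norm_num) hQ2
  have hlQ0 : 0 < Real.log Q := hl2.trans_le hlQ
  have hTpos : (0 : ℝ) < T := lt_of_lt_of_le (by positivity) hT
  have hT1 : 1 ≤ T := by exact_mod_cast hTpos
  refine ⟨hT1, ?_⟩
  have hexp : Real.log Q + Real.log (3 * C) ≤ T * Real.log (8 / 7) := by
    have h1 := mul_le_mul_of_nonneg_right hT hl8.le
    have h2 : (1 + Real.log (3 * C) / Real.log 2) / Real.log (8 / 7) * Real.log Q *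
        Real.log (8 / 7) = Real.log Q + Real.log (3 * C) * (Real.log Q / Real.log 2) := by
      field_simp
    have h3 : 1 ≤ Real.log Q / Real.log 2 := (one_le_div hl2).2 hlQ
    nlinarith
  have hpow : Q * (3 * C) * (7 / 8 : ℝ) ^ T ≤ 1 := by
    have h1 : Q * (3 * C) ≤ (8 / 7 : ℝ) ^ T := by
      rw [← Real.log_le_log_iff (by positivity) (by positivity), Real.log_pow,
        Real.log_mul (by positivity) (by positivity)]
      exact hexp
    calc Q * (3 * C) * (7 / 8 : ℝ) ^ T ≤ (8 / 7 : ℝ) ^ T * (7 / 8) ^ T := by gcongr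
      _ = 1 := by rw [← mul_pow]; norm_num
  have hpred : (7 / 8 : ℝ) ^ (T - 1) = 8 / 7 * (7 / 8) ^ T := by
    obtain ⟨t, rfl⟩ : ∃ t, T = t + 1 := ⟨T - 1, by omega⟩
    rw [Nat.add_sub_cancel, pow_succ]; ring
  -- `16 / 21 = 2 * (8 / 7) / 3`, where the `3` comes from the `3 * C` in the logarithm.
  calc m * (2 * ((7 / 8) ^ (T - 1) * K) / (η * lam))
      ≤ m * (2 * ((7 / 8) ^ (T - 1) * (C * (W * p))) / (η * lam)) := by gcongr
    _ = (16 / 21) * β * (Q * (3 * C) * (7 / 8 : ℝ) ^ T) := by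
        rw [hpred, hQ]; field_simp; ring
    _ ≤ (16 / 21) * β * 1 := by gcongr
    _ ≤ β := by linarith

theorem mainTheorem2 (c₀ R : ℝ) :
    ∃ c : ℝ, 0 < c ∧
      ∀ (n p m T : ℕ) (X : Matrix (Fin n) (Fin p) ℝ) (y : Fin n → ℝ) (θ₀ : Vec p)
        (σ η lam α β : ℝ),
        2 ≤ m → 0 ≤ σ → 0 < η → 0 < lam →
        α ∈ Set.Ioo (0 : ℝ) 1 → β ∈ Set.Ioo (0 : ℝ) 1 →
        ‖θ₀‖ ≤ R →
        NoClippingCondition X y σ η c₀ (m * T) →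
        c * Real.log (max σ (max 1 (η * lam)) * m * p / (η * lam * β)) ≤ (T : ℝ) →
        ∀ {Ω : Type*} [MeasurableSpace Ω] (P : Measure Ω) [IsProbabilityMeasure P] (j : Fin p),
          -- Independent runs: final iterates of `m` independent unclipped runs of `T` steps
          (∀ z : Fin m × ℕ → Ω → Vec p, IsGaussianNoise P lam z →
            1 - α - β ≤ P.real {ω | olsSolution X y j ∈ confInterval α
              (fun l : Fin m => dpgdIterate X y ⊤ η θ₀ (fun t => z (l, t) ω) T) j}) ∧
          -- Checkpoints: iterates `T, 2T, …, mT` of one unclipped run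
          (∀ z : ℕ → Ω → Vec p, IsGaussianNoise P lam z →
            1 - α - β ≤ P.real {ω | olsSolution X y j ∈ confInterval α
              (fun l : Fin m =>
                dpgdIterate X y ⊤ η θ₀ (fun t => z t ω) (((l : ℕ) + 1) * T)) j}) := by
  set C : ℝ := |R| + 2 * c₀ ^ 2 + 2 * |c₀| + 7 with hCdef
  have hC : 1 ≤ C := by
    have h1 := abs_nonneg R
    have h2 := abs_nonneg c₀
    have h3 := sq_nonneg c₀
    linarith
  have hl2 : 0 < Real.log 2 := Real.log_pos (by norm_num)
  have hl8 : 0 < Real.log (8 / 7) := Real.log_pos (by norm_num)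
  have hlC : 0 < Real.log (3 * C) := Real.log_pos (by linarith)
  refine ⟨(1 + Real.log (3 * C) / Real.log 2) / Real.log (8 / 7), by positivity, ?_⟩
  intro n p m T X y θ₀ σ η lam α β hm hσ hη hlam hα hβ hθ₀ hcond hT Ω _ P _ j
  have hηlam : 0 < η * lam := mul_pos hη hlam
  have hp : 1 ≤ p := j.pos
  have hp' : (1 : ℝ) ≤ p := by exact_mod_cast hp
  set W := max σ (max 1 (η * lam)) with hWdef
  have hσW : σ ≤ W := le_max_left _ _
  have hW1 : 1 ≤ W := (le_max_left _ _).trans (le_max_right _ _)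
  have hηW : η * lam ≤ W := (le_max_right _ _).trans (le_max_right _ _)
  set B := R + 2 * c₀ ^ 2 * σ * √p + 2 * |c₀| with hBdef
  set K := B + 7 * (η * lam) * p with hKdef
  have hKC : K ≤ C * (W * p) := by
    have hWp : W ≤ W * p := le_mul_of_one_le_right (by linarith) hp'
    have hsp : √(p : ℝ) ≤ p :=
      Real.sqrt_le_iff.2 ⟨by positivity, le_self_pow₀ hp' two_ne_zero⟩
    have h1 : R ≤ |R| * (W * p) :=
      (le_abs_self R).trans (le_mul_of_one_le_right (abs_nonneg _) (hW1.trans hWp))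
    have h2 : 2 * c₀ ^ 2 * σ * √p ≤ 2 * c₀ ^ 2 * (W * p) := by
      rw [mul_assoc]; gcongr
    have h3 : 2 * |c₀| ≤ 2 * |c₀| * (W * p) :=
      le_mul_of_one_le_right (by positivity) (hW1.trans hWp)
    have h4 : 7 * (η * lam) * p ≤ 7 * (W * p) := by
      rw [mul_assoc]; gcongr
    rw [hKdef, hBdef, hCdef]
    linarith
  obtain ⟨hT1, hbias⟩ := bias_le_of_log_le hC hηlam hβ hm hp hηW hKC hT
  have hN : 1 ≤ m * T := Nat.mul_pos (by omega) hT1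
  have hB := hcond.norm_step_initial_error_le hN hθ₀ hσ
  rw [← hBdef] at hB
  have hlow := hcond.1
  have hM := hcond.2.2.1
  have hB0 : 0 ≤ B := (norm_nonneg _).trans hB
  have hK0 : 0 ≤ K := by positivity
  constructor
  · intro z hz
    refine le_measureReal_of_forall_measurable_noise
      (E := fun w => olsSolution X y j ∈ confInterval α
        (fun l : Fin m => dpgdIterate X y ⊤ η θ₀ (fun t => w (l, t)) T) j) ?_ hz
    intro z hzm hz
    refine le_trans (by linarith) (one_sub_sub_le_coverage_of_blocks hm hT1 hM hη hlam hα.1 hK0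
      hzm hz (idx := fun l i => (l, i + 1)) ?_ ?_ (D := fun _ _ => θ₀ - olsSolution X y)
      (fun _ => measurable_const) (fun _ _ _ => measurable_const) ?_ (olsSolution X y) j ?_)
    · intro l i i' h
      simpa using h
    · intro k l hkl i _ i' _ h
      exact hkl (congrArg Prod.fst h)
    · intro l
      rw [lintegral_const, measure_univ, mul_one]
      exact ENNReal.ofReal_le_ofReal (hB.trans (le_add_of_nonneg_right (by positivity)))
    · intro l ω
      have := dpgdIterate_add_sub_olsSolution hlow y η θ₀ (fun t => z (l, t) ω) 0 T
      simpa [dpgdIterate] using this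
  · intro z hz
    refine le_measureReal_of_forall_measurable_noise
      (E := fun w => olsSolution X y j ∈ confInterval α
        (fun l : Fin m => dpgdIterate X y ⊤ η θ₀ w (((l : ℕ) + 1) * T)) j) ?_ hz
    intro z hzm hz
    refine le_trans (by linarith) (one_sub_sub_le_coverage_of_blocks hm hT1 hM hη hlam hα.1 hK0
      hzm hz (idx := fun l i => (l : ℕ) * T + i + 1) ?_ ?_
      (D := fun l ω => dpgdIterate X y ⊤ η θ₀ (fun t => z t ω) ((l : ℕ) * T) - olsSolution X y)
      (fun l => measurable_dpgdIterate_sub_olsSolution hlow y η θ₀ fun i _ _ => hzm i) ?_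
      (fun l => lintegral_norm_step_error_le hlow hη.le hlam.le hM hB hzm hz _)
      (olsSolution X y) j ?_)
    · intro l i i' h
      simpa using h
    · intro k l hkl i hi i' hi' h
      have h1 : (k : ℕ) * T + i = (l : ℕ) * T + i' := by simpa using h
      have h2 : (k : ℕ) = l := by
        have h3 := congrArg (· / T) h1
        simpa [mul_comm _ T, Nat.mul_add_div hT1, Nat.div_eq_of_lt hi,
          Nat.div_eq_of_lt hi'] using h3
      exact hkl (Fin.ext h2)
    · intro k l hlk
      refine @measurable_dpgdIterate_sub_olsSolution Ω (_) n p X hlow y η θ₀ z _ fun r _ hr => ?_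
      refine Measurable.of_comap_le (le_iSup₂_of_le r (fun i _ h => ?_) le_rfl)
      have h1 : (l : ℕ) * T ≤ k * T := Nat.mul_le_mul_right T hlk
      omega
    · intro l ω
      have := dpgdIterate_add_sub_olsSolution hlow y η θ₀ (fun t => z t ω) ((l : ℕ) * T) T
      rwa [← Nat.succ_mul] at this
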